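/- Let $X$ be a Banach space whose norm is uniformly Kadec--Klee (UKK): for every $\epsilon>0$ there is $\delta>0$ such that, whenever $(x_n)$ is a sequence in the closed unit ball of $X$ that converges weakly to $x_0$ and satisfies $\inf\{\|x_n-x_m\| : n\neq m\}>\epsilon$, one has $\|x_0\|\le 1-\delta$. Let $K\subseteq X$ be a nonempty weakly compact convex set. Call a semigroup $S$ left reversible if for all $a,b\in S$ there exist $c,d\in S$ with $ac=bd$. Let $\mathfrak{F}$ be a left reversible topological semigroup acting on $K$, with action $(T,x)\mapsto Tx$ satisfying $(TU)x=T(Ux)$, such that the action is separately continuous (each of $x\mapsto Tx$ and $T\mapsto Tx$ is continuous, $K$ carrying the norm topology) and each $T\in\mathfrak{F}$ acts as an isometry $K\to K$, i.e. $\|Tx-Ty\|=\|x-y\|$ for all $x,y\in K$ (surjectivity is not assumed). Assume that every sub-semigroup of $\mathfrak{F}$ is also left reversible. For $x\in K$ put $r(x,K)=\sup\{\|x-y\| : y\in K\}$, let $r(K)=\inf\{r(x,K) : x\in K\}$, and let $C(K)=\{x\in K : r(x,K)=r(K)\}$ be the Chebyshev center of $K$. Then there is a point $x_0\in C(K)$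 with $Tx_0=x_0$ for every $T\in\mathfrak{F}$. -/

import Mathlib

open Filter Topology

noncomputable section

/-- A semigroup is left reversible if any two principal right ideals `a S`, `b S` meet. -/
def LeftReversible (S : Type*) [Semigroup S] : Prop :=
  ∀ a b : S, ∃ c d : S, a * c = b * d

/-- A subset of a real normed space is weakly compact if it is compact in the weak topology. -/
def IsWeaklyCompact {X : Type*} [NormedAddCommGroup X] [NormedSpace ℝ X] (K : Set X) : Prop :=
  IsCompact (toWeakSpace ℝ X '' K)

/-- The separation constant `inf {‖x n - x m‖ : n ≠ m}` of a sequence. -/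
def seqSep {X : Type*} [NormedAddCommGroup X] (x : ℕ → X) : ℝ :=
  sInf {r : ℝ | ∃ n m : ℕ, n ≠ m ∧ r = ‖x n - x m‖}

/-- The norm of `X` is uniformly Kadec-Klee (UKK): for every `ε > 0` there is `δ > 0` such that
every weak limit of an `ε`-separated sequence in the closed unit ball has norm at most `1 - δ`. -/
def HasUKKNorm (X : Type*) [NormedAddCommGroup X] [NormedSpace ℝ X] : Prop :=
  ∀ ε : ℝ, 0 < ε → ∃ δ : ℝ, 0 < δ ∧
    ∀ (x : ℕ → X) (x₀ : X), (∀ n, x n ∈ Metric.closedBall (0 : X) 1) →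
      Tendsto (fun n => toWeakSpace ℝ X (x n)) atTop (𝓝 (toWeakSpace ℝ X x₀)) →
      ε < seqSep x → ‖x₀‖ ≤ 1 - δ

/-- `r(x, K) = sup {‖x - y‖ : y ∈ K}` (for `K` nonempty and bounded). -/
def radiusAt {X : Type*} [NormedAddCommGroup X] (x : X) (K : Set X) : ℝ :=
  sSup {r : ℝ | ∃ y ∈ K, r = ‖x - y‖}

/-- The Chebyshev radius `r(K) = inf {r(x, K) : x ∈ K}`. -/
def chebyshevRadius {X : Type*} [NormedAddCommGroup X] (K : Set X) : ℝ :=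
  sInf {r : ℝ | ∃ x ∈ K, r = radiusAt x K}

/-- The Chebyshev center `C(K) = {x ∈ K : r(x, K) = r(K)}`. -/
def chebyshevCenter {X : Type*} [NormedAddCommGroup X] (K : Set X) : Set X :=
  {x ∈ K | radiusAt x K = chebyshevRadius K}

end

/-! ### Weak compactness. -/

section WeakTopology

variable {X : Type*} [NormedAddCommGroup X] [NormedSpace ℝ X]

/-! For an invariant set `C`, left reversibility makes the images `s • C` a filter base. Isometry
makes the level sets of the asymptotic radius along this filter invariant, so on a minimal closed
convex invariant `C` that radius is a constant ρ. If ρ > 0, `C` contains a sequence with mutual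
distances near ρ, each term at distance about ρ from the hull of its predecessors. UKK puts a weak
subsequential limit well within ρ of every term, yet the limit is norm-close to a finite hull, hence
nearly ρ from some term (`HasUKKNorm.asymptoticRadius_nonpos`). So ρ ≤ 0, and `C` is a single fixed
point.

Without surjectivity `C(K)` need not be visibly invariant. The level set of `K` at height `r(K)` is
invariant and contains `C(K)`, and each fixed point in it lies in `C(K)`. -/

theorem continuous_strongDual_comp_toWeakSpace_symm (f : StrongDual ℝ X) :
    Continuous fun x : WeakSpace ℝ X => f ((toWeakSpace ℝ X).symm x) :=
  WeakBilin.eval_continuous (topDualPairing ℝ X).flip f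

theorem IsWeaklyCompact.isClosed {K : Set X} (hK : IsWeaklyCompact K) : IsClosed K := by
  have h : IsClosed (toWeakSpaceCLM ℝ X ⁻¹' (toWeakSpace ℝ X '' K)) :=
    IsClosed.preimage (toWeakSpaceCLM ℝ X).continuous (IsCompact.isClosed hK)
  convert h using 1
  exact (Set.preimage_image_eq K (toWeakSpace ℝ X).injective).symm

theorem isClosed_toWeakSpace_image {C : Set X} (hC : Convex ℝ C) (hcl : IsClosed C) :
    IsClosed (toWeakSpace ℝ X '' C) := by
  rw [← hcl.closure_eq, hC.toWeakSpace_closure ℝ]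
  exact isClosed_closure

theorem IsWeaklyCompact.of_subset {K C : Set X} (hK : IsWeaklyCompact K) (hCK : C ⊆ K)
    (hC : Convex ℝ C) (hcl : IsClosed C) : IsWeaklyCompact C :=
  IsCompact.of_isClosed_subset hK (isClosed_toWeakSpace_image hC hcl) (Set.image_mono hCK)

theorem IsWeaklyCompact.exists_norm_le {K : Set X} (hK : IsWeaklyCompact K) :
    ∃ M : ℝ, ∀ x ∈ K, ‖x‖ ≤ M := by
  have h := banach_steinhaus (g := fun x : K => NormedSpace.inclusionInDoubleDual ℝ X (x : X))
    fun f => by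
      obtain ⟨M, hM⟩ := (IsCompact.image hK
        (continuous_strongDual_comp_toWeakSpace_symm f)).isBounded.exists_norm_le
      refine ⟨M, fun x => ?_⟩
      exact hM _ ⟨_, ⟨x, x.2, rfl⟩, rfl⟩
  obtain ⟨M, hM⟩ := h
  refine ⟨M, fun x hx => ?_⟩
  rw [← (NormedSpace.inclusionInDoubleDualLi ℝ (E := X)).norm_map x]
  exact hM ⟨x, hx⟩

theorem IsWeaklyCompact.nonempty_iInter {K : Set X} (hK : IsWeaklyCompact K)
    {ι : Type*} [Nonempty ι] {t : ι → Set X} (hdir : Directed (· ⊇ ·) t)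
    (hne : ∀ i, (t i).Nonempty) (hconv : ∀ i, Convex ℝ (t i)) (hcl : ∀ i, IsClosed (t i))
    (htK : ∀ i, t i ⊆ K) : (⋂ i, t i).Nonempty := by
  have h := IsCompact.nonempty_iInter_of_directed_nonempty_isCompact_isClosed
    (fun i => toWeakSpace ℝ X '' t i)
    (fun i j => (hdir i j).imp fun _ h => ⟨Set.image_mono h.1, Set.image_mono h.2⟩)
    (fun i => (hne i).image _) (fun i => hK.of_subset (htK i) (hconv i) (hcl i))
    (fun i => isClosed_toWeakSpace_image (hconv i) (hcl i))
  obtain ⟨x, hx⟩ := h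
  rw [Set.mem_iInter] at hx
  refine ⟨(toWeakSpace ℝ X).symm x, Set.mem_iInter.2 fun i => ?_⟩
  obtain ⟨y, hy, rfl⟩ := hx i
  simpa using hy

/-- Countably many functionals separate the points of a separable subspace. -/
theorem exists_seq_strongDual_separating (D : Submodule ℝ X)
    [TopologicalSpace.SeparableSpace D] :
    ∃ f : ℕ → StrongDual ℝ X, ∀ x ∈ D, ∀ y ∈ D, x ≠ y → ∃ n, f n x ≠ f n y := by
  choose f hf1 hf2 using fun n =>
    exists_dual_vector'' ℝ ((TopologicalSpace.denseSeq D n : D) : X)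
  refine ⟨f, fun x hx y hy hxy => ?_⟩
  by_contra! hcon
  have hpos : 0 < ‖x - y‖ / 2 := by
    have := norm_sub_pos_iff.2 hxy
    positivity
  obtain ⟨n, hn⟩ := (TopologicalSpace.denseRange_denseSeq D).exists_dist_lt
    (⟨x - y, D.sub_mem hx hy⟩ : D) hpos
  set d : X := ((TopologicalSpace.denseSeq D n : D) : X) with hd
  have hn' : ‖(x - y) - d‖ < ‖x - y‖ / 2 := by
    rw [← dist_eq_norm]
    exact hn
  have h0 : f n (x - y) = 0 := by rw [map_sub, hcon n, sub_self]
  -- `f n` norms `d` but kills `x - y`, so `d` cannot be close to `x - y`.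
  have h1 : ‖d‖ ≤ ‖(x - y) - d‖ := by
    have h2 : f n ((x - y) - d) = -‖d‖ := by
      rw [map_sub, h0, hf2 n, zero_sub]
      rfl
    calc ‖d‖ = ‖f n ((x - y) - d)‖ := by rw [h2, norm_neg, norm_norm]
      _ ≤ 1 * ‖(x - y) - d‖ := (f n).le_of_opNorm_le (hf1 n) _
      _ = _ := one_mul _
  have h3 : ‖x - y‖ ≤ ‖(x - y) - d‖ + ‖d‖ := by
    simpa using norm_add_le ((x - y) - d) d
  linarith

/-- The sequential half of the Eberlein-Šmulian theorem. -/
theorem IsWeaklyCompact.exists_subseq_tendsto {K : Set X} (hK : IsWeaklyCompact K)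
    {x : ℕ → X} (hx : ∀ n, x n ∈ K) :
    ∃ x₀ ∈ K, ∃ φ : ℕ → ℕ, StrictMono φ ∧
      Tendsto (fun n => toWeakSpace ℝ X (x (φ n))) atTop (𝓝 (toWeakSpace ℝ X x₀)) := by
  -- Inside the separable closed span of the sequence, the weak topology on the compact piece `Q` is
  -- metrizable.
  set D : Submodule ℝ X := (Submodule.span ℝ (Set.range x)).topologicalClosure with hD
  have hsep : TopologicalSpace.IsSeparable (D : Set X) :=
    ((Set.countable_range x).isSeparable.span (R := ℝ)).closure
  have : TopologicalSpace.SeparableSpace D := hsep.separableSpace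
  obtain ⟨f, hf⟩ := exists_seq_strongDual_separating D
  have hDw : IsClosed (toWeakSpace ℝ X '' (D : Set X)) :=
    isClosed_toWeakSpace_image D.convex (Submodule.isClosed_topologicalClosure _)
  have hcomp : IsCompact (toWeakSpace ℝ X '' K ∩ toWeakSpace ℝ X '' (D : Set X)) :=
    IsCompact.inter_right hK hDw
  set Q := toWeakSpace ℝ X '' K ∩ toWeakSpace ℝ X '' (D : Set X) with hQ
  have : CompactSpace Q := isCompact_iff_compactSpace.1 hcomp
  have : TopologicalSpace.MetrizableSpace Q :=
    Metric.PiNatEmbed.TopologicalSpace.MetrizableSpace.of_countable_separating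
      (fun n (q : Q) => f n ((toWeakSpace ℝ X).symm q))
      (fun n => (continuous_strongDual_comp_toWeakSpace_symm (f n)).comp continuous_subtype_val)
      (by
        rintro ⟨_, _, a, ha, rfl⟩ ⟨_, _, b, hb, rfl⟩ hab
        simpa using hf a ha b hb fun h => hab (by simp [h]))
  have hxD : ∀ n, x n ∈ D := fun n =>
    Submodule.le_topologicalClosure _ (Submodule.subset_span ⟨n, rfl⟩)
  obtain ⟨⟨_, ⟨a, ha, rfl⟩, _⟩, φ, hφ, hlim⟩ := CompactSpace.tendsto_subseq
    (fun n => (⟨toWeakSpace ℝ X (x n), ⟨x n, hx n, rfl⟩, ⟨x n, hxD n, rfl⟩⟩ : Q))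
  exact ⟨a, ha, φ, hφ, (continuous_subtype_val.tendsto _).comp hlim⟩

end WeakTopology

/-! ### Constant asymptotic radius and UKK. -/

section AsymptoticRadius

variable {X : Type*} [NormedAddCommGroup X] [NormedSpace ℝ X]

/-- Choose `w` almost ρ away from the barycenter of `t` and norm that difference by `f`. The values
`f (x - w)` average almost ρ and none much exceeds ρ, so all are almost ρ; this half-space bound
passes to the hull. -/
theorem exists_far_from_convexHull {C : Set X} {F : Filter X} {ρ : ℝ} (hne : C.Nonempty)
    (hconv : Convex ℝ C) (hCF : C ∈ F)
    (hup : ∀ x ∈ C, ∀ r, ρ < r → ∀ᶠ y in F, ‖x - y‖ ≤ r)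
    (hlow : ∀ x ∈ C, ∀ r, r < ρ → ∃ᶠ y in F, r ≤ ‖x - y‖)
    (t : Finset X) (ht : ↑t ⊆ C) {η : ℝ} (hη : 0 < η) :
    ∃ w ∈ C, (∀ x ∈ t, ‖x - w‖ ≤ ρ + η) ∧ ∀ u ∈ convexHull ℝ (t : Set X), ρ - η ≤ ‖u - w‖ := by
  rcases t.eq_empty_or_nonempty with rfl | htne
  · obtain ⟨w, hw⟩ := hne
    exact ⟨w, hw, by simp, by simp⟩
  have hcard : (0 : ℝ) < t.card := by exact_mod_cast htne.card_pos
  set z : X := ∑ x ∈ t, (t.card : ℝ)⁻¹ • x with hz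
  have hzC : z ∈ C := by
    refine hconv.sum_mem (fun _ _ => by positivity) ?_ fun x hx => ht hx
    rw [Finset.sum_const, nsmul_eq_mul, mul_inv_cancel₀ hcard.ne']
  -- With N points, N(ρ - ε) - (N - 1)(ρ + ε) = ρ - (2N - 1)ε ≥ ρ - η.
  set ε : ℝ := η / (2 * t.card) with hε
  have hε0 : 0 < ε := by positivity
  have hεη : 2 * t.card * ε = η := by rw [hε]; field_simp
  have hev : ∀ᶠ y in F, ∀ x ∈ t, ‖x - y‖ ≤ ρ + ε :=
    (Filter.eventually_all_finset t).2 fun x hx => hup x (ht hx) _ (by linarith)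
  obtain ⟨w, hwz, hwt, hwC⟩ :=
    ((hlow z hzC (ρ - ε) (by linarith)).and_eventually (hev.and hCF)).exists
  have hcard1 : (1 : ℝ) ≤ t.card := by exact_mod_cast htne.card_pos
  refine ⟨w, hwC, fun x hx => (hwt x hx).trans (by nlinarith), ?_⟩
  obtain ⟨f, hf1, hf2⟩ := exists_dual_vector'' ℝ (z - w)
  have hfle : ∀ v : X, f v ≤ ‖v‖ := fun v =>
    (le_abs_self _).trans (by simpa using f.le_of_opNorm_le hf1 v)
  have hsum : ∑ x ∈ t, f (x - w) = t.card * ‖z - w‖ := by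
    have : f (z - w) = ‖z - w‖ := hf2
    rw [← this, map_sub, hz, map_sum]
    simp only [map_smul, map_sub, smul_eq_mul, ← Finset.mul_sum, Finset.sum_sub_distrib,
      Finset.sum_const, nsmul_eq_mul]
    field_simp
  have hlower : ∀ x ∈ t, ρ - η ≤ f (x - w) := by
    intro x hx
    classical
    have h1 : ∑ y ∈ t.erase x, f (y - w) ≤ (t.card - 1) * (ρ + ε) := by
      calc ∑ y ∈ t.erase x, f (y - w) ≤ ∑ _y ∈ t.erase x, (ρ + ε) :=
            Finset.sum_le_sum fun y hy => (hfle _).trans (hwt y (Finset.mem_of_mem_erase hy))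
        _ = (t.card - 1) * (ρ + ε) := by
            rw [Finset.sum_const, nsmul_eq_mul, Finset.card_erase_of_mem hx,
              Nat.cast_sub htne.card_pos, Nat.cast_one]
    have h2 := Finset.add_sum_erase t (fun y => f (y - w)) hx
    rw [hsum] at h2
    have h3 : (t.card : ℝ) * (ρ - ε) ≤ t.card * ‖z - w‖ :=
      mul_le_mul_of_nonneg_left hwz hcard.le
    nlinarith
  intro u hu
  have hmem : u ∈ {v : X | ρ - η + f w ≤ f v} := by
    refine convexHull_min (fun x hx => ?_) (convex_halfSpace_ge f.isLinear _) hu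
    have := hlower x hx
    rw [map_sub] at this
    change ρ - η + f w ≤ f x
    linarith
  have h4 : ρ - η ≤ f (u - w) := by
    rw [map_sub]
    have : ρ - η + f w ≤ f u := hmem
    linarith
  exact h4.trans (hfle _)

theorem exists_seq_far_from_convexHull {C : Set X} {F : Filter X} {ρ : ℝ} (hne : C.Nonempty)
    (hconv : Convex ℝ C) (hCF : C ∈ F)
    (hup : ∀ x ∈ C, ∀ r, ρ < r → ∀ᶠ y in F, ‖x - y‖ ≤ r)
    (hlow : ∀ x ∈ C, ∀ r, r < ρ → ∃ᶠ y in F, r ≤ ‖x - y‖)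
    {η : ℝ} (hη : 0 < η) :
    ∃ x : ℕ → X, (∀ n, x n ∈ C) ∧ (∀ m n, m < n → ‖x m - x n‖ ≤ ρ + η) ∧
      ∀ n, ∀ u ∈ convexHull ℝ (x '' Set.Iio n), ρ - η ≤ ‖u - x n‖ := by
  classical
  have h : ∀ t : {t : Finset X // (t : Set X) ⊆ C}, ∃ w ∈ C, (∀ x ∈ t.1, ‖x - w‖ ≤ ρ + η) ∧
      ∀ u ∈ convexHull ℝ (t.1 : Set X), ρ - η ≤ ‖u - w‖ := fun t =>
    exists_far_from_convexHull hne hconv hCF hup hlow t.1 t.2 hη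
  choose g hgC hgup hglow using h
  let T : ℕ → {t : Finset X // (t : Set X) ⊆ C} := fun n =>
    Nat.rec ⟨∅, by simp⟩ (fun _ t => ⟨insert (g t) t.1, by
      rw [Finset.coe_insert]
      exact Set.insert_subset (hgC t) t.2⟩) n
  have hT : ∀ n, ((T n).1 : Set X) = (fun k => g (T k)) '' Set.Iio n := by
    intro n
    induction n with
    | zero => simp [T]
    | succ n ih =>
      have : ((T (n + 1)).1 : Set X) = insert (g (T n)) ((T n).1 : Set X) :=
        Finset.coe_insert _ _
      rw [this, ih, ← Order.succ_eq_add_one, Order.Iio_succ_eq_insert, Set.image_insert_eq]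
  refine ⟨fun n => g (T n), fun n => hgC _, fun m n hmn => hgup _ _ ?_, fun n u hu => ?_⟩
  · rw [← Finset.mem_coe, hT]
    exact ⟨m, hmn, rfl⟩
  · exact hglow _ _ (by rwa [hT])

theorem weak_limit_mem_closure_convexHull {x : ℕ → X} {a : X}
    (h : Tendsto (fun n => toWeakSpace ℝ X (x n)) atTop (𝓝 (toWeakSpace ℝ X a))) :
    a ∈ closure (convexHull ℝ (Set.range x)) := by
  have h1 : toWeakSpace ℝ X a ∈ toWeakSpace ℝ X '' closure (convexHull ℝ (Set.range x)) := by
    rw [(convex_convexHull ℝ _).toWeakSpace_closure ℝ]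
    exact mem_closure_of_tendsto h (Eventually.of_forall fun n =>
      ⟨x n, subset_convexHull ℝ _ ⟨n, rfl⟩, rfl⟩)
  obtain ⟨b, hb, hba⟩ := h1
  rwa [← (toWeakSpace ℝ X).injective hba]

theorem le_seqSep {X : Type*} [NormedAddCommGroup X] {x : ℕ → X} {c : ℝ} (h : ∀ n m, n ≠ m → c ≤ ‖x n - x m‖) : c ≤ seqSep x := by
  refine le_csInf ⟨_, 0, 1, by simp, rfl⟩ ?_
  rintro _ ⟨n, m, hnm, rfl⟩
  exact h n m hnm

/-- In a UKK space a filter cannot have the same positive asymptotic radius at all points of a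
weakly compact convex set that carries it. -/
theorem HasUKKNorm.asymptoticRadius_nonpos (hX : HasUKKNorm X) {C : Set X} {F : Filter X} {ρ : ℝ}
    (hK : IsWeaklyCompact C) (hne : C.Nonempty) (hconv : Convex ℝ C) (hCF : C ∈ F)
    (hup : ∀ x ∈ C, ∀ r, ρ < r → ∀ᶠ y in F, ‖x - y‖ ≤ r)
    (hlow : ∀ x ∈ C, ∀ r, r < ρ → ∃ᶠ y in F, r ≤ ‖x - y‖) : ρ ≤ 0 := by
  by_contra! hρ
  obtain ⟨δ, hδ, hukk⟩ := hX (1 / 2) (by norm_num)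
  -- The first bound gives (ρ - η)/(ρ + η) ≥ 3/5 > 1/2; the second gives (1 - δ)(ρ + η) < ρ - 2η.
  set η : ℝ := min (ρ / 4) (ρ * δ / 4) with hηdef
  have hη : 0 < η := by positivity
  have hη1 : η ≤ ρ / 4 := min_le_left _ _
  have hη2 : η ≤ ρ * δ / 4 := min_le_right _ _
  obtain ⟨x, hxC, hxup, hxlow⟩ := exists_seq_far_from_convexHull hne hconv hCF hup hlow hη
  obtain ⟨a, -, φ, hφ, hlim⟩ := hK.exists_subseq_tendsto hxC
  have hR : 0 < ρ + η := by linarith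
  have hsep : ∀ m n, m ≠ n → ρ - η ≤ ‖x m - x n‖ := by
    have key : ∀ m n, m < n → ρ - η ≤ ‖x m - x n‖ := fun m n hmn =>
      hxlow n _ (subset_convexHull ℝ _ ⟨m, hmn, rfl⟩)
    intro m n hmn
    rcases hmn.lt_or_gt with h | h
    · exact key m n h
    · rw [norm_sub_rev]
      exact key n m h
  -- UKK for the tail recentred at `x m` and scaled into the unit ball; the shift by `m + 1` keeps
  -- only indices beyond `m`.
  have hupper : ∀ m, ‖a - x m‖ ≤ (1 - δ) * (ρ + η) := by
    intro m
    have hgt : ∀ n, m < φ (n + (m + 1)) := fun n =>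
      lt_of_lt_of_le (by omega) (hφ.le_apply (x := n + (m + 1)))
    have hle := hukk (fun n => (ρ + η)⁻¹ • (x (φ (n + (m + 1))) - x m)) ((ρ + η)⁻¹ • (a - x m))
      (fun n => by
        rw [mem_closedBall_zero_iff, norm_smul, norm_inv, Real.norm_of_nonneg hR.le,
          inv_mul_le_iff₀ hR, mul_one, norm_sub_rev]
        exact hxup _ _ (hgt n))
      (by
        simp only [map_smul, map_sub]
        exact ((hlim.comp (tendsto_add_atTop_nat (m + 1))).sub_const _).const_smul _)
      (by
        refine lt_of_lt_of_le (b := (ρ + η)⁻¹ * (ρ - η)) ?_ (le_seqSep fun i j hij => ?_)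
        · rw [lt_inv_mul_iff₀ hR]
          linarith
        · rw [← smul_sub, sub_sub_sub_cancel_right, norm_smul, norm_inv, Real.norm_of_nonneg hR.le]
          exact mul_le_mul_of_nonneg_left (hsep _ _ (hφ.injective.ne (by omega)))
            (by positivity))
    rw [norm_smul, norm_inv, Real.norm_of_nonneg hR.le, inv_mul_le_iff₀ hR] at hle
    linarith
  have hlower : ∃ m, ρ - 2 * η ≤ ‖a - x m‖ := by
    obtain ⟨u, hu, hau⟩ := Metric.mem_closure_iff.1 (weak_limit_mem_closure_convexHull hlim) η hη
    rw [dist_eq_norm] at hau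
    have : ∃ n, u ∈ convexHull ℝ (x '' Set.Iio n) := by
      rw [convexHull_eq_union_convexHull_finite_subsets] at hu
      simp only [Set.mem_iUnion] at hu
      obtain ⟨t, ht, hut⟩ := hu
      have ht' : ∃ n, (t : Set X) ⊆ x '' Set.Iio n := by
        have hdir : Monotone fun n => x '' Set.Iio n := fun i j hij =>
          Set.image_mono (Set.Iio_subset_Iio hij)
        have hcov : (t : Set X) ⊆ ⋃ n, x '' Set.Iio n := fun y hy => by
          obtain ⟨k, rfl⟩ := ht hy
          exact Set.mem_iUnion.2 ⟨φ k + 1, φ k, Nat.lt_succ_self _, rfl⟩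
        exact hdir.directed_le.exists_mem_subset_of_finset_subset_biUnion hcov
      obtain ⟨n, hn⟩ := ht'
      exact ⟨n, convexHull_mono hn hut⟩
    obtain ⟨n, hn⟩ := this
    refine ⟨n, ?_⟩
    have h1 := hxlow n u hn
    have h2 : ‖u - x n‖ ≤ ‖a - u‖ + ‖a - x n‖ := by
      rw [norm_sub_rev a u]
      simpa using norm_add_le (u - a) (a - x n)
    linarith
  obtain ⟨m, hm⟩ := hlower
  have := hupper m
  nlinarith

end AsymptoticRadius

/-! ### Chebyshev radius bounds. -/

section Chebyshev

variable {X : Type*} [NormedAddCommGroup X]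

theorem bddAbove_norm_sub {K : Set X} (hK : ∃ M : ℝ, ∀ x ∈ K, ‖x‖ ≤ M) (x : X) :
    BddAbove {r : ℝ | ∃ y ∈ K, r = ‖x - y‖} := by
  obtain ⟨M, hM⟩ := hK
  refine ⟨‖x‖ + M, ?_⟩
  rintro _ ⟨y, hy, rfl⟩
  exact (norm_sub_le x y).trans (by linarith [hM y hy])

theorem norm_sub_le_radiusAt {K : Set X} (hK : ∃ M : ℝ, ∀ x ∈ K, ‖x‖ ≤ M) (x : X) {y : X}
    (hy : y ∈ K) : ‖x - y‖ ≤ radiusAt x K :=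
  le_csSup (bddAbove_norm_sub hK x) ⟨y, hy, rfl⟩

theorem radiusAt_le {K : Set X} (hne : K.Nonempty) {x : X} {r : ℝ}
    (h : ∀ y ∈ K, ‖x - y‖ ≤ r) : radiusAt x K ≤ r := by
  obtain ⟨y, hy⟩ := hne
  refine csSup_le ⟨_, y, hy, rfl⟩ ?_
  rintro _ ⟨z, hz, rfl⟩
  exact h z hz

theorem chebyshevRadius_le_radiusAt {K : Set X} (hK : ∃ M : ℝ, ∀ x ∈ K, ‖x‖ ≤ M) {x : X}
    (hx : x ∈ K) : chebyshevRadius K ≤ radiusAt x K := by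
  refine csInf_le ⟨0, ?_⟩ ⟨x, hx, rfl⟩
  rintro _ ⟨y, hy, rfl⟩
  exact (norm_nonneg _).trans (norm_sub_le_radiusAt hK y hy)

theorem mem_chebyshevCenter_of_forall_gt {K : Set X} (hK : ∃ M : ℝ, ∀ x ∈ K, ‖x‖ ≤ M) {x : X}
    (hx : x ∈ K) (h : ∀ r, chebyshevRadius K < r → ∀ y ∈ K, ‖x - y‖ ≤ r) :
    x ∈ chebyshevCenter K :=
  ⟨hx, le_antisymm (le_of_forall_gt_imp_ge_of_dense fun r hr => radiusAt_le ⟨x, hx⟩ (h r hr))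
    (chebyshevRadius_le_radiusAt hK hx)⟩

end Chebyshev

/-! ### Minimal invariant sets and fixed points. -/

section FixedPoints

variable {X : Type*} [NormedAddCommGroup X]

/-- The points of `C` whose asymptotic radius along the filter `F` is at most `ρ`. -/
def asymptoticLevelSet (C : Set X) (F : Filter X) (ρ : ℝ) : Set X :=
  {x ∈ C | ∀ r, ρ < r → ∀ᶠ y in F, ‖x - y‖ ≤ r}

theorem isClosed_asymptoticLevelSet {C : Set X} (F : Filter X) (ρ : ℝ) (hC : IsClosed C) :
    IsClosed (asymptoticLevelSet C F ρ) := by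
  refine isClosed_of_closure_subset fun x hx => ⟨?_, fun r hr => ?_⟩
  · exact closure_minimal (fun y hy => hy.1) hC hx
  · obtain ⟨z, hz, hxz⟩ := Metric.mem_closure_iff.1 hx ((r - ρ) / 2) (by linarith)
    rw [dist_eq_norm] at hxz
    filter_upwards [hz.2 ((r + ρ) / 2) (by linarith)] with y hy
    have : ‖x - y‖ ≤ ‖x - z‖ + ‖z - y‖ := by simpa using norm_add_le (x - z) (z - y)
    linarith

theorem convex_asymptoticLevelSet [NormedSpace ℝ X] {C : Set X} (F : Filter X) (ρ : ℝ)
    (hC : Convex ℝ C) : Convex ℝ (asymptoticLevelSet C F ρ) := by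
  intro x hx z hz a b ha hb hab
  refine ⟨hC hx.1 hz.1 ha hb hab, fun r hr => ?_⟩
  filter_upwards [hx.2 r hr, hz.2 r hr] with y hxy hzy
  have h := (convex_closedBall y r) (mem_closedBall_iff_norm.2 hxy) (mem_closedBall_iff_norm.2 hzy)
    ha hb hab
  exact mem_closedBall_iff_norm.1 h

variable {K : Set X} {S : Type*} [Semigroup S] [SemigroupAction S K]

variable (S) in
/-- The set `C` is mapped into itself by a semigroup acting on `K`. -/
def IsActionInvariant (K : Set X) [SemigroupAction S K] (C : Set X) : Prop :=
  ∀ (s : S) (x : K), (x : X) ∈ C → ((s • x : K) : X) ∈ C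

variable (S) in
/-- The filter generated by the images of `C` under a semigroup acting on `K`. -/
def actionFilter (K : Set X) [SemigroupAction S K] (C : Set X) : Filter X :=
  ⨅ s : S, 𝓟 {y | ∃ x : K, (x : X) ∈ C ∧ ((s • x : K) : X) = y}

/-- If `a * c = b * d`, the image of `C` under this element lies in both `a • C` and `b • C`, so the
infimum is directed. -/
theorem mem_actionFilter_iff [Nonempty S] (hrev : LeftReversible S) {C : Set X}
    (hC : IsActionInvariant S K C) {A : Set X} :
    A ∈ actionFilter S K C ↔ ∃ s : S, ∀ x : K, (x : X) ∈ C → ((s • x : K) : X) ∈ A := by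
  have hdir : Directed (· ≥ ·)
      fun s : S => 𝓟 {y : X | ∃ x : K, (x : X) ∈ C ∧ ((s • x : K) : X) = y} := by
    intro a b
    obtain ⟨c, d, hcd⟩ := hrev a b
    refine ⟨a * c, principal_mono.2 ?_, principal_mono.2 ?_⟩
    · rintro _ ⟨x, hx, rfl⟩
      exact ⟨c • x, hC c x hx, by rw [mul_smul]⟩
    · rintro _ ⟨x, hx, rfl⟩
      exact ⟨d • x, hC d x hx, by rw [hcd, mul_smul]⟩
  rw [actionFilter, mem_iInf_of_directed hdir]
  refine exists_congr fun s => ?_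
  rw [mem_principal]
  exact ⟨fun h x hx => h ⟨x, hx, rfl⟩, by rintro h _ ⟨x, hx, rfl⟩; exact h x hx⟩

/-- A bound on `s • C` for `x` becomes the same bound on `(t * s) • C` for `t • x`. -/
theorem isActionInvariant_asymptoticLevelSet [Nonempty S] (hrev : LeftReversible S)
    (hisom : ∀ s : S, Isometry fun x : K => s • x) {C : Set X}
    (hC : IsActionInvariant S K C) (ρ : ℝ) :
    IsActionInvariant S K (asymptoticLevelSet C (actionFilter S K C) ρ) := by
  intro t x hx
  refine ⟨hC t x hx.1, fun r hr => ?_⟩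
  obtain ⟨s, hs⟩ := (mem_actionFilter_iff hrev hC).1 (hx.2 r hr)
  refine (mem_actionFilter_iff hrev hC).2 ⟨t * s, fun y hy => ?_⟩
  have h := (hisom t).dist_eq x (s • y)
  rw [← mul_smul, Subtype.dist_eq, Subtype.dist_eq, dist_eq_norm, dist_eq_norm] at h
  exact h.trans_le (hs y hy)

theorem actionFilter_neBot [Nonempty S] (hrev : LeftReversible S) {C : Set X}
    (hC : IsActionInvariant S K C) (hCK : C ⊆ K) (hne : C.Nonempty) :
    (actionFilter S K C).NeBot := by
  rw [neBot_iff, Ne, ← empty_mem_iff_bot, mem_actionFilter_iff hrev hC]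
  rintro ⟨s, hs⟩
  obtain ⟨x, hx⟩ := hne
  exact hs ⟨x, hCK hx⟩ hx

variable [NormedSpace ℝ X]

theorem exists_minimal_invariant_subset (hK : IsWeaklyCompact K) {A : Set X} (hAK : A ⊆ K)
    (hne : A.Nonempty) (hconv : Convex ℝ A) (hcl : IsClosed A) (hinv : IsActionInvariant S K A) :
    ∃ C ⊆ A, C.Nonempty ∧ Convex ℝ C ∧ IsClosed C ∧ IsActionInvariant S K C ∧
      ∀ B ⊆ C, B.Nonempty → Convex ℝ B → IsClosed B → IsActionInvariant S K B → B = C := by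
  obtain ⟨C, hCA, hC⟩ := zorn_superset_nonempty
    {C : Set X | C ⊆ K ∧ C.Nonempty ∧ Convex ℝ C ∧ IsClosed C ∧ IsActionInvariant S K C}
    (fun c hc hchain hcne => by
      have : Nonempty c := hcne.to_subtype
      refine ⟨⋂ i : c, (i : Set X), ⟨?_, ?_, ?_, ?_, ?_⟩,
        fun s hs => Set.iInter_subset_of_subset ⟨s, hs⟩ subset_rfl⟩
      · obtain ⟨s, hs⟩ := hcne
        exact (Set.iInter_subset_of_subset ⟨s, hs⟩ subset_rfl).trans (hc hs).1
      · refine hK.nonempty_iInter ?_ (fun i => (hc i.2).2.1) (fun i => (hc i.2).2.2.1)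
          (fun i => (hc i.2).2.2.2.1) (fun i => (hc i.2).1)
        intro i j
        rcases hchain.total i.2 j.2 with h | h
        · exact ⟨i, subset_rfl, h⟩
        · exact ⟨j, h, subset_rfl⟩
      · exact convex_iInter fun i => (hc i.2).2.2.1
      · exact isClosed_iInter fun i => (hc i.2).2.2.2.1
      · intro s x hx
        rw [Set.mem_iInter] at hx ⊢
        exact fun i => (hc i.2).2.2.2.2 s x (hx i))
    A ⟨hAK, hne, hconv, hcl, hinv⟩
  refine ⟨C, hCA, hC.prop.2.1, hC.prop.2.2.1, hC.prop.2.2.2.1, hC.prop.2.2.2.2, ?_⟩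
  intro B hBC h1 h2 h3 h4
  exact (hC.eq_of_subset ⟨hBC.trans hC.prop.1, h1, h2, h3, h4⟩ hBC)

/-- A left reversible semigroup of isometries of a weakly compact set in a UKK space has a common
fixed point in every nonempty closed convex invariant subset. -/
theorem HasUKKNorm.exists_common_fixedPoint (hX : HasUKKNorm X) (hK : IsWeaklyCompact K)
    [Nonempty S] (hrev : LeftReversible S) (hisom : ∀ s : S, Isometry fun x : K => s • x)
    {A : Set X} (hAK : A ⊆ K) (hne : A.Nonempty) (hconv : Convex ℝ A) (hcl : IsClosed A)
    (hinv : IsActionInvariant S K A) : ∃ x : K, (x : X) ∈ A ∧ ∀ s : S, s • x = x := by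
  obtain ⟨C, hCA, hCne, hCconv, hCcl, hCinv, hmin⟩ :=
    exists_minimal_invariant_subset hK hAK hne hconv hcl hinv
  have hCK := hCA.trans hAK
  have hCcomp := hK.of_subset hCK hCconv hCcl
  obtain ⟨M, hM⟩ := hCcomp.exists_norm_le
  set F := actionFilter S K C with hF
  have hbot : F.NeBot := actionFilter_neBot hrev hCinv hCK hCne
  have hCF : C ∈ F :=
    (mem_actionFilter_iff hrev hCinv).2 ⟨Classical.arbitrary S, fun x hx => hCinv _ x hx⟩
  -- By minimality a level set is empty or all of `C`, so the asymptotic radius is constant.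
  have hlevel : ∀ ρ, (asymptoticLevelSet C F ρ).Nonempty → asymptoticLevelSet C F ρ = C :=
    fun ρ h => hmin _ (fun x hx => hx.1) h (convex_asymptoticLevelSet F ρ hCconv)
      (isClosed_asymptoticLevelSet F ρ hCcl)
      (isActionInvariant_asymptoticLevelSet hrev hisom hCinv ρ)
  set P : Set ℝ := {ρ | (asymptoticLevelSet C F ρ).Nonempty} with hP
  have hPbdd : BddBelow P := by
    refine ⟨0, fun ρ hρ => ?_⟩
    obtain ⟨x, hx⟩ := hρ
    refine le_of_forall_gt_imp_ge_of_dense fun r hr => ?_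
    obtain ⟨y, hy⟩ := (hx.2 r hr).exists
    exact (norm_nonneg _).trans hy
  have hPne : P.Nonempty := by
    obtain ⟨x, hx⟩ := hCne
    refine ⟨M + M, x, hx, fun r hr => ?_⟩
    filter_upwards [hCF] with y hy
    linarith [norm_sub_le x y, hM x hx, hM y hy]
  have hup : ∀ x ∈ C, ∀ r, sInf P < r → ∀ᶠ y in F, ‖x - y‖ ≤ r := by
    intro x hx r hr
    obtain ⟨ρ, hρP, hρ⟩ := exists_lt_of_csInf_lt hPne hr
    rw [← hlevel ρ hρP] at hx
    exact hx.2 r hρ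
  have hlow : ∀ x ∈ C, ∀ r, r < sInf P → ∃ᶠ y in F, r ≤ ‖x - y‖ := by
    intro x hx r hr hcon
    refine (csInf_le hPbdd (show r ∈ P from ⟨x, hx, fun r' hr' => ?_⟩)).not_gt hr
    filter_upwards [hcon] with y hy
    exact (not_le.1 hy).le.trans hr'.le
  have hzero := hX.asymptoticRadius_nonpos hCcomp hCne hCconv hCF hup hlow
  have hsub : ∀ x ∈ C, ∀ y ∈ C, x = y := by
    intro x hx y hy
    rw [← sub_eq_zero, ← norm_le_zero_iff]
    refine le_of_forall_gt_imp_ge_of_dense fun r hr => ?_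
    obtain ⟨z, hz1, hz2⟩ := ((hup x hx (r / 2) (by linarith)).and
      (hup y hy (r / 2) (by linarith))).exists
    rw [norm_sub_rev] at hz2
    have : ‖x - y‖ ≤ ‖x - z‖ + ‖z - y‖ := by simpa using norm_add_le (x - z) (z - y)
    linarith
  obtain ⟨x, hx⟩ := hCne
  exact ⟨⟨x, hCK hx⟩, hCA hx, fun s =>
    Subtype.ext (hsub _ (hCinv s ⟨x, hCK hx⟩ hx) _ hx)⟩

theorem IsWeaklyCompact.chebyshevCenter_nonempty (hK : IsWeaklyCompact K) (hne : K.Nonempty)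
    (hconv : Convex ℝ K) : (chebyshevCenter K).Nonempty := by
  have hbdd := hK.exists_norm_le
  have : Nonempty (Set.Ioi (chebyshevRadius K)) := Set.nonempty_Ioi.to_subtype
  let t : Set.Ioi (chebyshevRadius K) → Set X := fun r =>
    K ∩ ⋂ y ∈ K, Metric.closedBall y r
  have hmem : ∀ r x, x ∈ t r ↔ x ∈ K ∧ ∀ y ∈ K, ‖x - y‖ ≤ r := fun r x => by
    simp [t, dist_eq_norm]
  obtain ⟨x, hx⟩ := hK.nonempty_iInter (t := t)
    (Monotone.directed_ge fun r r' hrr' x hx => by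
      rw [hmem] at hx ⊢
      exact ⟨hx.1, fun y hy => (hx.2 y hy).trans hrr'⟩)
    (fun r => by
      obtain ⟨x, hx⟩ := hne
      obtain ⟨_, ⟨z, hz, rfl⟩, hlt⟩ := exists_lt_of_csInf_lt
        (s := {r : ℝ | ∃ x ∈ K, r = radiusAt x K}) ⟨_, x, hx, rfl⟩ r.2
      exact ⟨z, (hmem r z).2 ⟨hz, fun y hy => (norm_sub_le_radiusAt hbdd z hy).trans hlt.le⟩⟩)
    (fun r => hconv.inter (convex_iInter₂ fun y _ => convex_closedBall y _))
    (fun r => hK.isClosed.inter (isClosed_biInter fun y _ => Metric.isClosed_closedBall))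
    (fun r => Set.inter_subset_left)
  rw [Set.mem_iInter] at hx
  have hxK : x ∈ K := (hx (Classical.arbitrary _)).1
  exact ⟨x, mem_chebyshevCenter_of_forall_gt hbdd hxK fun r hr => ((hmem ⟨r, hr⟩ x).1 (hx _)).2⟩

end FixedPoints

theorem theoremP {X : Type*} [NormedAddCommGroup X] [NormedSpace ℝ X] [CompleteSpace X]
    (hX : HasUKKNorm X)
    (K : Set X) (hKne : K.Nonempty) (hKconv : Convex ℝ K) (hKcomp : IsWeaklyCompact K)
    {S : Type*} [Semigroup S] [TopologicalSpace S] [ContinuousMul S]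
    [SemigroupAction S K]
    (hisom : ∀ s : S, Isometry (fun x : K => s • x))
    (hcont_left : ∀ s : S, Continuous (fun x : K => s • x))
    (hcont_right : ∀ x : K, Continuous (fun s : S => s • x))
    (hrev : LeftReversible S)
    (hsub : ∀ T : Subsemigroup S, LeftReversible T) :
    ∃ x : K, (x : X) ∈ chebyshevCenter K ∧ ∀ s : S, s • x = x := by
  obtain ⟨c, hcK, hc⟩ := hKcomp.chebyshevCenter_nonempty hKne hKconv
  rcases isEmpty_or_nonempty S with hS | hS
  · exact ⟨⟨c, hcK⟩, ⟨hcK, hc⟩, fun s => isEmptyElim s⟩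
  have hbdd := hKcomp.exists_norm_le
  have hinv : IsActionInvariant S K K := fun s x _ => (s • x).2
  obtain ⟨x, hxA, hfix⟩ := hX.exists_common_fixedPoint hKcomp hrev hisom
    (A := asymptoticLevelSet K (actionFilter S K K) (chebyshevRadius K)) (fun x hx => hx.1)
    ⟨c, hcK, fun r hr => (mem_actionFilter_iff hrev hinv).2 ⟨Classical.arbitrary S, fun y _ =>
      (norm_sub_le_radiusAt hbdd c (_ • y : K).2).trans (hc.le.trans hr.le)⟩⟩
    (convex_asymptoticLevelSet _ _ hKconv) (isClosed_asymptoticLevelSet _ _ hKcomp.isClosed)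
    (isActionInvariant_asymptoticLevelSet hrev hisom hinv _)
  refine ⟨x, mem_chebyshevCenter_of_forall_gt hbdd x.2 fun r hr y hy => ?_, hfix⟩
  obtain ⟨s, hs⟩ := (mem_actionFilter_iff hrev hinv).1 (hxA.2 r hr)
  -- As `s • x = x`, the bound on `s • K` pulls back to all of `K`.
  have h := (hisom s).dist_eq x ⟨y, hy⟩
  simp only [hfix, Subtype.dist_eq, dist_eq_norm] at h
  exact h.symm.trans_le (hs ⟨y, hy⟩ hy)
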